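/- Consider a five-dimensional stationary axisymmetric vacuum space-time near a nut at which two spacelike rods meet. Let its metric be \[ ds^2=\sum_{i,j} J_{ij}\,dx^i dx^j+e^{2\nu}(dr^2+dz^2),\qquad (x^0,x^1,x^2)=(t,\varphi,\psi), \] where the symmetric real matrix $J$ and the real function $\nu$ are $C^2$ functions of $(r,z)$ on a half disc $r>0$, $r^2+z^2<\varepsilon^2$ (some $\varepsilon>0$), $\det J=-r^2$, and $\varphi,\psi$ have period $2\pi$. Assume the vacuum Einstein equations \[ \partial_r(rJ^{-1}\partial_rJ)+\partial_z(rJ^{-1}\partial_zJ)=0,\qquad \partial_\xi\log(re^{2\nu})=\tfrac{ir}{2}\operatorname{tr}(J^{-1}J_\xi J^{-1}J_\xi),\qquad \partial_\xi=\tfrac12(\partial_z-i\partial_r). \] Introduce $u,v\ge 0$ by $r=uv$, $z=\tfrac12(v^2-u^2)$, so that the nut is $u=v=0$, and assume that $J$ has the normal form \[ J=\begin{pmatrix}X_0&u^2Y_0&v^2Z_0\\ u^2Y_0&u^2U_0&u^2v^2V_0\\ v^2Z_0&u^2v^2V_0&v^2W_0\end{pmatrix}\qquad(u,v>0,\ u^2+v^2<2\varepsilon),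 \] where $X_0,Y_0,Z_0,U_0,V_0,W_0$ are functions of $(u,v)$ that are $C^1$ on $\{u,v\ge0,\ u^2+v^2<2\varepsilon\}$ (up to and including the axis), with $U_0>0$ on the rod $u=0$, $v>0$ (where $\partial_\varphi$ vanishes) and $W_0>0$ on the rod $v=0$, $u>0$ (where $\partial_\psi$ vanishes). Suppose that there are no conical singularities on the two rods: at each point of the rod $u=0$, $0<v<\sqrt{2\varepsilon}$, the length of the closed orbit of $\partial_\varphi$ through $(u,v)$ divided by the proper distance $\int_0^u e^{\nu(s,v)}\sqrt{s^2+v^2}\,ds$ from the rod tends to $2\pi$ as $u\to0^+$ (here $\nu(s,v)$ denotes $\nu$ at the point with $(u,v)$-coordinates $(s,v)$), and correspondingly for the orbits of $\partial_\psi$ at the rod $v=0$. Then the limits of $U_0$ along the rod $u=0$ and of $W_0$ along the rod $v=0$ at the nut exist and agree: \[ \lim_{v\to0^+}U_0(0,v)=\lim_{u\to0^+}W_0(u,0). \] -/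

import Mathlib

open Filter Topology

noncomputable section

namespace Nut

/-- `∂F/∂r` for a function `F(r,z)`. -/
def partialR (F : ℝ → ℝ → ℝ) (r z : ℝ) : ℝ := deriv (fun s => F s z) r

/-- `∂F/∂z` for a function `F(r,z)`. -/
def partialZ (F : ℝ → ℝ → ℝ) (r z : ℝ) : ℝ := deriv (fun s => F r s) z

/-- The derivative `∂F/∂ξ = (∂F/∂z - i ∂F/∂r)/2` with respect to `ξ = z + i r`. -/
def partialXi (F : ℝ → ℝ → ℝ) (r z : ℝ) : ℂ :=
  (1 / 2) * ((partialZ F r z : ℂ) - Complex.I * (partialR F r z : ℂ))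

/-- Entrywise `∂/∂r` of a matrix function of `(r,z)`. -/
def matR (J : ℝ → ℝ → Matrix (Fin 3) (Fin 3) ℝ) (r z : ℝ) : Matrix (Fin 3) (Fin 3) ℝ :=
  Matrix.of fun i j => partialR (fun s y => J s y i j) r z

/-- Entrywise `∂/∂z` of a matrix function of `(r,z)`. -/
def matZ (J : ℝ → ℝ → Matrix (Fin 3) (Fin 3) ℝ) (r z : ℝ) : Matrix (Fin 3) (Fin 3) ℝ :=
  Matrix.of fun i j => partialZ (fun s y => J s y i j) r z

/-- Entrywise `∂/∂ξ` of a matrix function of `(r,z)`. -/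
def matXi (J : ℝ → ℝ → Matrix (Fin 3) (Fin 3) ℝ) (r z : ℝ) : Matrix (Fin 3) (Fin 3) ℂ :=
  Matrix.of fun i j => partialXi (fun s y => J s y i j) r z

/-- The inverse of `J(r,z)`, regarded as a complex matrix. -/
def invC (J : ℝ → ℝ → Matrix (Fin 3) (Fin 3) ℝ) (r z : ℝ) : Matrix (Fin 3) (Fin 3) ℂ :=
  ((J r z)⁻¹).map (fun x : ℝ => (x : ℂ))

/-- The half disc `r > 0`, `r² + z² < ε²` in the `(r,z)` half plane; its centre is the nut. -/
def halfDisc (ε : ℝ) : Set (ℝ × ℝ) := {p | 0 < p.1 ∧ p.1 ^ 2 + p.2 ^ 2 < ε ^ 2}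

/-- The part `u ≥ 0`, `v ≥ 0`, `u² + v² < 2ε` of the `(u,v)` plane, including both rods
`u = 0`, `v = 0` and the nut. Under `r = uv`, `z = (v² - u²)/2` one has `u² + v² = 2 √(r² + z²)`,
so that its interior corresponds to `halfDisc ε`. -/
def quarterDisc (ε : ℝ) : Set (ℝ × ℝ) := {p | 0 ≤ p.1 ∧ 0 ≤ p.2 ∧ p.1 ^ 2 + p.2 ^ 2 < 2 * ε}

/-- The vacuum Einstein equations, on `halfDisc ε`, for the stationary axisymmetric metric
`∑ J_{ij}(r,z) dxⁱ dxʲ + e^{2ν(r,z)} (dr² + dz²)`, `(x⁰,x¹,x²) = (t,φ,ψ)`, in Weyl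
coordinates (`det J = -r²`):
`∂_r (r J⁻¹ ∂_r J) + ∂_z (r J⁻¹ ∂_z J) = 0` and
`∂_ξ log (r e^{2ν}) = (i r / 2) tr (J⁻¹ J_ξ J⁻¹ J_ξ)`, `ξ = z + i r`. -/
structure IsVacuum (J : ℝ → ℝ → Matrix (Fin 3) (Fin 3) ℝ) (ν : ℝ → ℝ → ℝ) (ε : ℝ) : Prop where
  contDiff_J : ∀ i j, ContDiffOn ℝ 2 (fun p : ℝ × ℝ => J p.1 p.2 i j) (halfDisc ε)
  contDiff_nu : ContDiffOn ℝ 2 (fun p : ℝ × ℝ => ν p.1 p.2) (halfDisc ε)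
  symm : ∀ r z, (r, z) ∈ halfDisc ε → (J r z).IsSymm
  det : ∀ r z, (r, z) ∈ halfDisc ε → (J r z).det = -r ^ 2
  sigma_model : ∀ r z, (r, z) ∈ halfDisc ε →
    matR (fun s y => s • ((J s y)⁻¹ * matR J s y)) r z +
      matZ (fun s y => s • ((J s y)⁻¹ * matZ J s y)) r z = 0
  conformal_factor : ∀ r z, (r, z) ∈ halfDisc ε →
    partialXi (fun s y => Real.log (s * Real.exp (2 * ν s y))) r z =
      (Complex.I * (r : ℂ) / 2) *
        (invC J r z * matXi J r z * invC J r z * matXi J r z).trace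

/-- The metric in the coordinates `(t,φ,ψ)` (left indices) and `(u,v)` (right indices), where
`r = uv` and `z = (v² - u²)/2`: the form `∑ J_{ij} dxⁱ dxʲ + e^{2ν} (u² + v²) (du² + dv²)`. -/
def metric (J : ℝ → ℝ → Matrix (Fin 3) (Fin 3) ℝ) (ν : ℝ → ℝ → ℝ) (u v : ℝ) :
    Matrix (Fin 3 ⊕ Fin 2) (Fin 3 ⊕ Fin 2) ℝ :=
  Matrix.fromBlocks (J (u * v) ((v ^ 2 - u ^ 2) / 2)) 0 0
    ((Real.exp (2 * ν (u * v) ((v ^ 2 - u ^ 2) / 2)) * (u ^ 2 + v ^ 2)) •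
      (1 : Matrix (Fin 2) (Fin 2) ℝ))

/-- `J` has, around the nut `u = v = 0`, the normal form
`(X₀, u²Y₀, v²Z₀; ·, u²U₀, u²v²V₀; ·, ·, v²W₀)`, with coefficients that are continuously
differentiable up to and including the rods and the nut; both adjacent rods are spacelike:
`∂_φ` vanishes on `u = 0`, `∂_ψ` vanishes on `v = 0`, and each is spacelike near its rod. -/
structure IsNutNormalForm (J : ℝ → ℝ → Matrix (Fin 3) (Fin 3) ℝ) (ε : ℝ)
    (X₀ Y₀ Z₀ U₀ V₀ W₀ : ℝ → ℝ → ℝ) : Prop where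
  contDiff_X : ContDiffOn ℝ 1 (fun p : ℝ × ℝ => X₀ p.1 p.2) (quarterDisc ε)
  contDiff_Y : ContDiffOn ℝ 1 (fun p : ℝ × ℝ => Y₀ p.1 p.2) (quarterDisc ε)
  contDiff_Z : ContDiffOn ℝ 1 (fun p : ℝ × ℝ => Z₀ p.1 p.2) (quarterDisc ε)
  contDiff_U : ContDiffOn ℝ 1 (fun p : ℝ × ℝ => U₀ p.1 p.2) (quarterDisc ε)
  contDiff_V : ContDiffOn ℝ 1 (fun p : ℝ × ℝ => V₀ p.1 p.2) (quarterDisc ε)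
  contDiff_W : ContDiffOn ℝ 1 (fun p : ℝ × ℝ => W₀ p.1 p.2) (quarterDisc ε)
  eq_form : ∀ u v, 0 < u → 0 < v → u ^ 2 + v ^ 2 < 2 * ε →
    J (u * v) ((v ^ 2 - u ^ 2) / 2) =
      !![X₀ u v, u ^ 2 * Y₀ u v, v ^ 2 * Z₀ u v;
         u ^ 2 * Y₀ u v, u ^ 2 * U₀ u v, u ^ 2 * v ^ 2 * V₀ u v;
         v ^ 2 * Z₀ u v, u ^ 2 * v ^ 2 * V₀ u v, v ^ 2 * W₀ u v]
  spacelike_phi : ∀ v, 0 < v → v ^ 2 < 2 * ε → 0 < U₀ 0 v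
  spacelike_psi : ∀ u, 0 < u → u ^ 2 < 2 * ε → 0 < W₀ u 0

/-- Length of the closed orbit of `∂_φ` (with `φ` of period `2π`) through the point `(u,v)`. -/
def circumferencePhi (J : ℝ → ℝ → Matrix (Fin 3) (Fin 3) ℝ) (ν : ℝ → ℝ → ℝ) (u v : ℝ) : ℝ :=
  ∫ _φ in (0 : ℝ)..(2 * Real.pi), Real.sqrt (metric J ν u v (Sum.inl 1) (Sum.inl 1))

/-- Length of the closed orbit of `∂_ψ` (with `ψ` of period `2π`) through the point `(u,v)`. -/
def circumferencePsi (J : ℝ → ℝ → Matrix (Fin 3) (Fin 3) ℝ) (ν : ℝ → ℝ → ℝ) (u v : ℝ) : ℝ :=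
  ∫ _ψ in (0 : ℝ)..(2 * Real.pi), Real.sqrt (metric J ν u v (Sum.inl 2) (Sum.inl 2))

/-- Proper distance from the rod `u = 0` to the point `(u,v)` along the line of constant `v`. -/
def radiusPhi (J : ℝ → ℝ → Matrix (Fin 3) (Fin 3) ℝ) (ν : ℝ → ℝ → ℝ) (u v : ℝ) : ℝ :=
  ∫ s in (0 : ℝ)..u, Real.sqrt (metric J ν s v (Sum.inr 0) (Sum.inr 0))

/-- Proper distance from the rod `v = 0` to the point `(u,v)` along the line of constant `u`. -/
def radiusPsi (J : ℝ → ℝ → Matrix (Fin 3) (Fin 3) ℝ) (ν : ℝ → ℝ → ℝ) (u v : ℝ) : ℝ :=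
  ∫ s in (0 : ℝ)..v, Real.sqrt (metric J ν u s (Sum.inr 1) (Sum.inr 1))

/-- No conical singularity on the rod `u = 0`: small circles around each of its points (other
than the nut) have circumference asymptotic to `2π` times their proper radius. -/
def NoConicalPhi (J : ℝ → ℝ → Matrix (Fin 3) (Fin 3) ℝ) (ν : ℝ → ℝ → ℝ) (ε : ℝ) : Prop :=
  ∀ v, 0 < v → v ^ 2 < 2 * ε →
    Tendsto (fun u => circumferencePhi J ν u v / radiusPhi J ν u v) (𝓝[>] 0) (𝓝 (2 * Real.pi))

/-- No conical singularity on the rod `v = 0`. -/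
def NoConicalPsi (J : ℝ → ℝ → Matrix (Fin 3) (Fin 3) ℝ) (ν : ℝ → ℝ → ℝ) (ε : ℝ) : Prop :=
  ∀ u, 0 < u → u ^ 2 < 2 * ε →
    Tendsto (fun v => circumferencePsi J ν u v / radiusPsi J ν u v) (𝓝[>] 0) (𝓝 (2 * Real.pi))

end Nut

end

/-! Put `ζ = v + i u`, so that `ξ = ζ² / 2` and `∂_ζ = ζ ∂_ξ`. In `(u, v)` the metric on the orbit
space is `e^{2ν} (u² + v²) (du² + dv²)`. The whole theorem follows once the logarithm of this
conformal factor is known to extend continuously to a function `g` across both rods and the nut: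
absence of conical singularities then says `U₀ = e^g` on one rod and `W₀ = e^g` on the other, and
both limits are `e^{g(0,0)}`.

The extension comes from a bound on the gradient. Write `J = D K D` with `D = diag(1, u, v)`; the
matrix `K` is `C¹` up to the corner and `det K = -1`, so `K⁻¹ = -adj K` is `C¹` there too. With `D_ζ
= D E`, `E = diag(0, -i/(2u), 1/(2v))`, the trace of `(J⁻¹ J_ζ)²` expands as `2 tr E² + 2 tr (K⁻¹ E
K E)` plus terms containing `K_ζ`. The off-diagonal entries of `K` and `K⁻¹` carry enough factors
`u`, `v` for `tr (K⁻¹ E K E)` to differ from `tr E²` by a bounded amount, so the trace is `-1/u² +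
1/v² + R` with `R = O(1 + 1/u + 1/v)` (`sq_mul_trace_eq`).

In the equation for the conformal factor the double poles cancel exactly against `∂_ξ log r` and
`∂_ζ log (u² + v²)`, leaving `ζ ∂_ζ log(e^{2ν}(u² + v²)) = (i u v / 2) R`
(`partialXi_logConformal`). Since `u v (1/u + 1/v) = u + v ≤ 2 |ζ|`, the gradient is bounded near
the nut, and on a convex region this gives a Lipschitz function. -/

/-! ### Entrywise bounds and trace identities for matrices -/

lemma Matrix.norm_mul_apply_le_of_entries {n : Type*} [Fintype n] {A B : Matrix n n ℂ} {a b : ℝ}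
    (hA : ∀ i j, ‖A i j‖ ≤ a) (hB : ∀ i j, ‖B i j‖ ≤ b) (i j : n) :
    ‖(A * B) i j‖ ≤ Fintype.card n * (a * b) := by
  rw [Matrix.mul_apply]
  refine (norm_sum_le _ _).trans ((Finset.sum_le_sum fun k _ => ?_).trans_eq
    (by rw [Finset.sum_const, nsmul_eq_mul, Finset.card_univ]))
  rw [norm_mul]
  exact mul_le_mul (hA _ _) (hB _ _) (norm_nonneg _) ((norm_nonneg _).trans (hA i k))

lemma Matrix.norm_trace_le_of_entries {n : Type*} [Fintype n] {A : Matrix n n ℂ} {a : ℝ}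
    (hA : ∀ i j, ‖A i j‖ ≤ a) : ‖A.trace‖ ≤ Fintype.card n * a := by
  refine (norm_sum_le _ _).trans ((Finset.sum_le_sum fun k _ => hA k k).trans_eq
    (by rw [Finset.sum_const, nsmul_eq_mul, Finset.card_univ]))

/-- Trace of the square of `K⁻¹ (E K + M + K E)`, where `P = K⁻¹`. -/
lemma Matrix.trace_sq_conj {n R : Type*} [Fintype n] [DecidableEq n] [CommRing R]
    {P K E M : Matrix n n R} (hKP : K * P = 1) (hPK : P * K = 1) :
    ((P * (E * K + M + K * E)) * (P * (E * K + M + K * E))).trace =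
      2 * (E * E).trace + 2 * (P * E * K * E).trace + 2 * (E * P * M).trace +
        2 * (P * E * M).trace + (P * M * (P * M)).trace := by
  -- The first summand `P E K` is conjugate to `E`, so its square contributes a second copy of `tr
  -- E²`.
  have h : P * (E * K + M + K * E) = P * E * K + P * M + E := by
    rw [mul_add, mul_add, ← mul_assoc, ← mul_assoc, hPK, one_mul]
  have h1 : (P * E * K * (P * E * K)).trace = (E * E).trace := by
    rw [show P * E * K * (P * E * K) = P * (E * (K * P) * E * K) by simp only [mul_assoc],
      hKP, mul_one, Matrix.trace_mul_comm, mul_assoc, hKP, mul_one]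
  have h2 : (P * E * K * (P * M)).trace = (P * E * M).trace := by
    rw [show P * E * K * (P * M) = P * E * (K * P) * M by simp only [mul_assoc], hKP, mul_one]
  have h3 : (P * M * (P * E * K)).trace = (P * E * M).trace := by
    rw [Matrix.trace_mul_comm, h2]
  have h4 : (E * (P * E * K)).trace = (P * E * K * E).trace := Matrix.trace_mul_comm _ _
  have h5 : (P * M * E).trace = (E * P * M).trace := by
    rw [Matrix.trace_mul_comm, mul_assoc]
  have h6 : (E * (P * M)).trace = (E * P * M).trace := by rw [mul_assoc]
  rw [h]
  simp only [mul_add, add_mul, Matrix.trace_add, h1, h2, h3, h4, h5, h6]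
  ring

namespace Nut

/-- The regular part of the normal form: `J = D K D` with `D = diag(1, u, v)`. -/
def regularPart {R : Type*} [CommRing R] (X Y Z U V W u v : R) : Matrix (Fin 3) (Fin 3) R :=
  !![X, u * Y, v * Z; u * Y, U, u * v * V; v * Z, u * v * V, W]

/-- Only diagonal products `(K⁻¹)_{ii} K_{ii}` meet a double pole. The determinant condition turns
each into `1` minus off-diagonal products; these carry the factor `u²` in row 1 and `v²` in row 2,
which cancels the pole. The mixed term `1/(uv)` meets an off-diagonal product divisible by `u² v²`.
-/
lemma trace_conj_regularPart (X Y Z U V W u v : ℂ) (hu : u ≠ 0) (hv : v ≠ 0)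
    (hdet : (regularPart X Y Z U V W u v).det = -1) :
    (-(regularPart X Y Z U V W u v).adjugate * Matrix.diagonal ![0, -Complex.I / (2 * u), 1 / (2 * v)] *
      regularPart X Y Z U V W u v * Matrix.diagonal ![0, -Complex.I / (2 * u), 1 / (2 * v)]).trace =
    -1 / (4 * u ^ 2) + 1 / (4 * v ^ 2) +
      ((Y * (Y * W - v ^ 2 * V * Z) + v ^ 2 * V * (X * V - Y * Z)) / 4
        - (Z * (U * Z - u ^ 2 * Y * V) + u ^ 2 * V * (X * V - Y * Z)) / 4
        - Complex.I * (u * v * V * (X * V - Y * Z)) / 2) := by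
  have hI : Complex.I ^ 2 = -1 := Complex.I_sq
  rw [regularPart, Matrix.det_fin_three] at hdet
  simp only [regularPart, Matrix.adjugate_fin_three, Matrix.trace_fin_three, Matrix.mul_apply,
    Fin.sum_univ_three, Matrix.diagonal, Matrix.of_apply, Matrix.neg_apply] at hdet ⊢
  simp at hdet ⊢
  field_simp
  linear_combination 4 * (v^2 - u^2) * hdet + (-4 * v^2 * X * W * U + 4 * v^4 * Z^2 * U) * hI

/-- A function that is `C¹` within a convex set is Lipschitz near each of its points, boundary
included, and a Lipschitz constant bounds the full derivative at nearby interior points. Stating it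
for all large `C` lets finitely many functions share one constant. -/
lemma contDiffWithinAt_eventually_bound {s : Set (ℝ × ℝ)} (hs : Convex ℝ s) {x : ℝ × ℝ} (hx : x ∈ s)
    {f : ℝ × ℝ → ℝ} (hf : ContDiffOn ℝ 1 f s) :
    ∀ᶠ C in atTop, ∀ᶠ p in 𝓝[interior s] x, |f p| ≤ C ∧ DifferentiableAt ℝ f p ∧
      |fderiv ℝ f p (1, 0)| ≤ C ∧ |fderiv ℝ f p (0, 1)| ≤ C := by
  obtain ⟨K, t, ht, hL⟩ := (hf x hx).exists_lipschitzOnWith hs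
  have hc : Tendsto (fun p => |f p|) (𝓝[interior s] x) (𝓝 |f x|) :=
    ((hf x hx).continuousWithinAt.mono interior_subset).abs
  filter_upwards [eventually_gt_atTop |f x|, eventually_ge_atTop (K : ℝ)] with C hC hKC
  obtain ⟨o, ho, hxo, hot⟩ := mem_nhdsWithin.1 ht
  filter_upwards [hc.eventually_le_const hC, self_mem_nhdsWithin,
    mem_nhdsWithin_of_mem_nhds (ho.mem_nhds hxo)] with p h1 h2 h3
  have hpt : t ∈ 𝓝 p := by
    filter_upwards [ho.mem_nhds h3, mem_interior_iff_mem_nhds.1 h2] with q h4 h5 using hot ⟨h4, h5⟩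
  have hn : ‖fderiv ℝ f p‖ ≤ K := norm_fderiv_le_of_lipschitzOn ℝ hpt hL
  refine ⟨h1, (hf.contDiffAt (mem_interior_iff_mem_nhds.1 h2)).differentiableAt one_ne_zero, ?_, ?_⟩
  · have := (fderiv ℝ f p).le_opNorm ((1 : ℝ), (0 : ℝ))
    rw [Real.norm_eq_abs, Prod.norm_def] at this
    simp at this; linarith
  · have := (fderiv ℝ f p).le_opNorm ((0 : ℝ), (1 : ℝ))
    rw [Real.norm_eq_abs, Prod.norm_def] at this
    simp at this; linarith

/-! ### Calculus of `∂_ξ` and the change of variables from `(r, z)` to `(u, v)` -/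

lemma partialR_eq_fderiv {F : ℝ → ℝ → ℝ} {p : ℝ × ℝ}
    (h : DifferentiableAt ℝ (fun p : ℝ × ℝ => F p.1 p.2) p) :
    partialR F p.1 p.2 = fderiv ℝ (fun p : ℝ × ℝ => F p.1 p.2) p (1, 0) :=
  (h.hasFDerivAt.comp_hasDerivAt_of_eq p.1
    ((hasDerivAt_id p.1).prodMk (hasDerivAt_const p.1 p.2)) rfl).deriv

lemma partialZ_eq_fderiv {F : ℝ → ℝ → ℝ} {p : ℝ × ℝ}
    (h : DifferentiableAt ℝ (fun p : ℝ × ℝ => F p.1 p.2) p) :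
    partialZ F p.1 p.2 = fderiv ℝ (fun p : ℝ × ℝ => F p.1 p.2) p (0, 1) :=
  (h.hasFDerivAt.comp_hasDerivAt_of_eq p.2
    ((hasDerivAt_const p.2 p.1).prodMk (hasDerivAt_id p.2)) rfl).deriv

lemma hasDerivAt_comp_partial {F : ℝ → ℝ → ℝ} {a b : ℝ → ℝ} {a' b' t : ℝ}
    (h : DifferentiableAt ℝ (fun p : ℝ × ℝ => F p.1 p.2) (a t, b t))
    (ha : HasDerivAt a a' t) (hb : HasDerivAt b b' t) :
    HasDerivAt (fun s => F (a s) (b s))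
      (a' * partialR F (a t) (b t) + b' * partialZ F (a t) (b t)) t := by
  have := h.hasFDerivAt.comp_hasDerivAt_of_eq t (ha.prodMk hb) rfl
  rw [partialR_eq_fderiv h, partialZ_eq_fderiv h]
  refine this.congr_deriv ?_
  rw [show ((a', b') : ℝ × ℝ) = a' • (1, 0) + b' • (0, 1) by simp, map_add, map_smul, map_smul]
  rfl

/-- The `u`-derivative of a function of `(r, z)`. -/
lemma hasDerivAt_weyl_u {F : ℝ → ℝ → ℝ} {u v : ℝ}
    (h : DifferentiableAt ℝ (fun p : ℝ × ℝ => F p.1 p.2) (u * v, (v ^ 2 - u ^ 2) / 2)) :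
    HasDerivAt (fun s => F (s * v) ((v ^ 2 - s ^ 2) / 2))
      (v * partialR F (u * v) ((v ^ 2 - u ^ 2) / 2) -
        u * partialZ F (u * v) ((v ^ 2 - u ^ 2) / 2)) u := by
  have ha : HasDerivAt (fun s : ℝ => s * v) v u := by simpa using (hasDerivAt_id u).mul_const v
  have hb : HasDerivAt (fun s : ℝ => (v ^ 2 - s ^ 2) / 2) (-u) u := by
    refine ((((hasDerivAt_id u).pow 2).const_sub (v ^ 2)).div_const 2).congr_deriv ?_
    simp
    ring
  refine (hasDerivAt_comp_partial (a := fun s => s * v) (b := fun s => (v ^ 2 - s ^ 2) / 2)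
    h ha hb).congr_deriv ?_
  ring

/-- The `v`-derivative of a function of `(r, z)`. -/
lemma hasDerivAt_weyl_v {F : ℝ → ℝ → ℝ} {u v : ℝ}
    (h : DifferentiableAt ℝ (fun p : ℝ × ℝ => F p.1 p.2) (u * v, (v ^ 2 - u ^ 2) / 2)) :
    HasDerivAt (fun s => F (u * s) ((s ^ 2 - u ^ 2) / 2))
      (u * partialR F (u * v) ((v ^ 2 - u ^ 2) / 2) +
        v * partialZ F (u * v) ((v ^ 2 - u ^ 2) / 2)) v := by
  have ha : HasDerivAt (fun s : ℝ => u * s) u v := by simpa using (hasDerivAt_id v).const_mul u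
  have hb : HasDerivAt (fun s : ℝ => (s ^ 2 - u ^ 2) / 2) v v := by
    refine ((((hasDerivAt_id v).pow 2).sub_const (u ^ 2)).div_const 2).congr_deriv ?_
    simp
  exact hasDerivAt_comp_partial (a := fun s => u * s) (b := fun s => (s ^ 2 - u ^ 2) / 2) h ha hb

/-- The chain rule for `ξ = z + i r = ζ² / 2`, `ζ = v + i u`. -/
lemma partialXi_weyl {F : ℝ → ℝ → ℝ} {u v : ℝ}
    (h : DifferentiableAt ℝ (fun p : ℝ × ℝ => F p.1 p.2) (u * v, (v ^ 2 - u ^ 2) / 2)) :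
    partialXi (fun u v => F (u * v) ((v ^ 2 - u ^ 2) / 2)) u v =
      (v + Complex.I * u) * partialXi F (u * v) ((v ^ 2 - u ^ 2) / 2) := by
  rw [partialXi, partialZ, partialR, (hasDerivAt_weyl_u h).deriv, (hasDerivAt_weyl_v h).deriv,
    partialXi]
  push_cast
  linear_combination (1 / 2) * (u : ℂ) * (partialR F (u * v) ((v ^ 2 - u ^ 2) / 2) : ℂ) * Complex.I_sq

lemma quarterDisc_eq (ε : ℝ) : quarterDisc ε =
    (Set.Ici 0 ×ˢ Set.Ici 0) ∩ {p : ℝ × ℝ | p.1 ^ 2 + p.2 ^ 2 < 2 * ε} := by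
  ext p; simp [quarterDisc, and_assoc, Prod.le_def]

lemma convex_quarterDisc (ε : ℝ) : Convex ℝ (quarterDisc ε) := by
  rw [quarterDisc_eq]
  refine ((convex_Ici 0).prod (convex_Ici 0)).inter fun x hx y hy a b ha hb hab => ?_
  simp only [Set.mem_ofPred_eq] at hx hy ⊢
  have h1 := (even_two.convexOn_pow (𝕜 := ℝ)).2 (Set.mem_univ x.1) (Set.mem_univ y.1) ha hb hab
  have h2 := (even_two.convexOn_pow (𝕜 := ℝ)).2 (Set.mem_univ x.2) (Set.mem_univ y.2) ha hb hab
  have h3 := convex_Iio (2 * ε) hx hy ha hb hab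
  simp only [smul_eq_mul, Set.mem_Iio, Prod.fst_add, Prod.snd_add, Prod.smul_fst,
    Prod.smul_snd] at h1 h2 h3 ⊢
  linarith

lemma interior_quarterDisc (ε : ℝ) : interior (quarterDisc ε) =
    (Set.Ioi 0 ×ˢ Set.Ioi 0) ∩ {p : ℝ × ℝ | p.1 ^ 2 + p.2 ^ 2 < 2 * ε} := by
  have : IsOpen {p : ℝ × ℝ | p.1 ^ 2 + p.2 ^ 2 < 2 * ε} :=
    isOpen_lt (by fun_prop) continuous_const
  rw [quarterDisc_eq, interior_inter, interior_prod_eq, interior_Ici, this.interior_eq]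

lemma mem_halfDisc_weyl {ε u v : ℝ} (hu : 0 < u) (hv : 0 < v) (h : u ^ 2 + v ^ 2 < 2 * ε) :
    (u * v, (v ^ 2 - u ^ 2) / 2) ∈ halfDisc ε := by
  refine ⟨mul_pos hu hv, ?_⟩
  have : ((u ^ 2 + v ^ 2) / 2) ^ 2 < ε ^ 2 := pow_lt_pow_left₀ (by linarith) (by positivity) two_ne_zero
  calc _ = ((u ^ 2 + v ^ 2) / 2) ^ 2 := by ring
    _ < _ := this

lemma isOpen_halfDisc (ε : ℝ) : IsOpen (halfDisc ε) :=
  (isOpen_lt continuous_const continuous_fst).inter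
    (isOpen_lt (f := fun p : ℝ × ℝ => p.1 ^ 2 + p.2 ^ 2) (by fun_prop) continuous_const)

lemma partialXi_eq_fderiv {F : ℝ → ℝ → ℝ} {u v : ℝ}
    (h : DifferentiableAt ℝ (fun p : ℝ × ℝ => F p.1 p.2) (u, v)) :
    partialXi F u v = (1 / 2) * ((fderiv ℝ (fun p : ℝ × ℝ => F p.1 p.2) (u, v) (0, 1) : ℂ) -
      Complex.I * (fderiv ℝ (fun p : ℝ × ℝ => F p.1 p.2) (u, v) (1, 0) : ℂ)) := by
  rw [partialXi, partialR_eq_fderiv h, partialZ_eq_fderiv h]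

lemma norm_partialXi_le {F : ℝ → ℝ → ℝ} {u v C : ℝ}
    (h : DifferentiableAt ℝ (fun p : ℝ × ℝ => F p.1 p.2) (u, v))
    (h1 : |fderiv ℝ (fun p : ℝ × ℝ => F p.1 p.2) (u, v) (1, 0)| ≤ C)
    (h2 : |fderiv ℝ (fun p : ℝ × ℝ => F p.1 p.2) (u, v) (0, 1)| ≤ C) :
    ‖partialXi F u v‖ ≤ C := by
  rw [partialXi_eq_fderiv h, norm_mul]
  refine (mul_le_mul_of_nonneg_left (norm_sub_le _ _) (norm_nonneg _)).trans ?_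
  simp only [norm_mul, Complex.norm_I, Complex.norm_real, Real.norm_eq_abs]
  norm_num
  linarith

/-- For real `F` the real and imaginary parts of `∂_ξ F` are, up to sign, half the partial
derivatives. Each partial is thus at most `2 C`, and in the sup norm of the plane the two bounds
add. -/
lemma norm_fderiv_le_of_partialXi {F : ℝ → ℝ → ℝ} {u v C : ℝ}
    (h : DifferentiableAt ℝ (fun p : ℝ × ℝ => F p.1 p.2) (u, v)) (hC : ‖partialXi F u v‖ ≤ C) :
    ‖fderiv ℝ (fun p : ℝ × ℝ => F p.1 p.2) (u, v)‖ ≤ 4 * C := by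
  have h1 := (Complex.abs_re_le_norm _).trans hC
  have h2 := (Complex.abs_im_le_norm _).trans hC
  rw [partialXi_eq_fderiv h] at h1 h2
  simp [abs_mul] at h1 h2
  refine ContinuousLinearMap.opNorm_le_bound _ (by linarith [(norm_nonneg _).trans hC]) fun q => ?_
  have hq : q = q.1 • ((1 : ℝ), (0 : ℝ)) + q.2 • ((0 : ℝ), (1 : ℝ)) := by ext <;> simp
  have e1 : |q.1| ≤ ‖q‖ := norm_fst_le q
  have e2 : |q.2| ≤ ‖q‖ := norm_snd_le q
  conv_lhs => rw [hq, map_add, map_smul, map_smul]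
  refine (norm_add_le _ _).trans ?_
  rw [norm_smul, norm_smul]
  simp only [Real.norm_eq_abs]
  have a1 := mul_le_mul e1 (show |fderiv ℝ (fun p : ℝ × ℝ => F p.1 p.2) (u, v) (1, 0)| ≤ 2 * C by
    linarith) (abs_nonneg _) (norm_nonneg _)
  have a2 := mul_le_mul e2 (show |fderiv ℝ (fun p : ℝ × ℝ => F p.1 p.2) (u, v) (0, 1)| ≤ 2 * C by
    linarith) (abs_nonneg _) (norm_nonneg _)
  linarith

lemma partialXi_congr {F G : ℝ → ℝ → ℝ} {u v : ℝ}
    (h : ∀ᶠ p : ℝ × ℝ in 𝓝 (u, v), F p.1 p.2 = G p.1 p.2) : partialXi F u v = partialXi G u v := by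
  have h1 : (fun s => F s v) =ᶠ[𝓝 u] fun s => G s v :=
    (Continuous.prodMk continuous_id continuous_const).continuousAt.eventually h
  have h2 : (fun s => F u s) =ᶠ[𝓝 v] fun s => G u s :=
    (Continuous.prodMk continuous_const continuous_id).continuousAt.eventually h
  rw [partialXi, partialXi, partialR, partialR, partialZ, partialZ, h1.deriv_eq, h2.deriv_eq]

lemma differentiableAt_slices {F : ℝ → ℝ → ℝ} {u v : ℝ}
    (h : DifferentiableAt ℝ (fun p : ℝ × ℝ => F p.1 p.2) (u, v)) :
    DifferentiableAt ℝ (fun s => F s v) u ∧ DifferentiableAt ℝ (fun s => F u s) v :=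
  ⟨(hasDerivAt_comp_partial (a := fun s => s) (b := fun _ => v) h (hasDerivAt_id u)
    (hasDerivAt_const u v)).differentiableAt,
   (hasDerivAt_comp_partial (a := fun _ => u) (b := fun s => s) h
    (hasDerivAt_const v u) (hasDerivAt_id v)).differentiableAt⟩

lemma partialXi_mul {F G : ℝ → ℝ → ℝ} {u v : ℝ}
    (hF : DifferentiableAt ℝ (fun p : ℝ × ℝ => F p.1 p.2) (u, v))
    (hG : DifferentiableAt ℝ (fun p : ℝ × ℝ => G p.1 p.2) (u, v)) :
    partialXi (fun u v => F u v * G u v) u v =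
      partialXi F u v * G u v + F u v * partialXi G u v := by
  obtain ⟨f1, f2⟩ := differentiableAt_slices hF
  obtain ⟨g1, g2⟩ := differentiableAt_slices hG
  simp only [partialXi, partialR, partialZ, deriv_fun_mul f1 g1, deriv_fun_mul f2 g2]
  push_cast; ring

lemma partialXi_add {F G : ℝ → ℝ → ℝ} {u v : ℝ}
    (hF : DifferentiableAt ℝ (fun p : ℝ × ℝ => F p.1 p.2) (u, v))
    (hG : DifferentiableAt ℝ (fun p : ℝ × ℝ => G p.1 p.2) (u, v)) :
    partialXi (fun u v => F u v + G u v) u v = partialXi F u v + partialXi G u v := by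
  obtain ⟨f1, f2⟩ := differentiableAt_slices hF
  obtain ⟨g1, g2⟩ := differentiableAt_slices hG
  simp only [partialXi, partialR, partialZ, deriv_fun_add f1 g1, deriv_fun_add f2 g2]
  push_cast; ring

/-- Here `u² + v² = ζ ζ̄`, and `log ζ̄` is annihilated by `∂_ζ`. With arguments `(u, v)` in place of
`(r, z)`, `partialXi` is `∂_ζ`. -/
lemma partialXi_log_sq_add_sq {u v : ℝ} (h : u ^ 2 + v ^ 2 ≠ 0) :
    partialXi (fun u v => Real.log (u ^ 2 + v ^ 2)) u v = 1 / (v + Complex.I * u) := by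
  have hd1 : HasDerivAt (fun s => Real.log (s ^ 2 + v ^ 2)) (2 * u / (u ^ 2 + v ^ 2)) u := by
    refine (((hasDerivAt_pow 2 u).add_const (v ^ 2)).log h).congr_deriv (by simp)
  have hd2 : HasDerivAt (fun s => Real.log (u ^ 2 + s ^ 2)) (2 * v / (u ^ 2 + v ^ 2)) v := by
    refine (((hasDerivAt_pow 2 v).const_add (u ^ 2)).log h).congr_deriv (by simp)
  have hp : (v + Complex.I * u) * (v - Complex.I * u) = (u : ℂ) ^ 2 + v ^ 2 := by
    linear_combination -(u : ℂ) ^ 2 * Complex.I_sq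
  have hc : (u : ℂ) ^ 2 + v ^ 2 ≠ 0 := by exact_mod_cast h
  have hz : (v + Complex.I * u : ℂ) ≠ 0 := fun h0 => hc (by rw [← hp, h0, zero_mul])
  rw [partialXi, partialR, partialZ, hd1.deriv, hd2.deriv]
  push_cast
  have hr : 1 / (v + Complex.I * u : ℂ) = (v - Complex.I * u) / (u ^ 2 + v ^ 2) := by
    rw [div_eq_div_iff hz hc, ← hp]; ring
  rw [hr]
  ring

/-! ### Factorization `J = D K D` and the expansion of the trace -/

/-- Conjugating by `D` does not change the trace. -/
lemma trace_sq_conj_diag {P N D D' : Matrix (Fin 3) (Fin 3) ℂ} (h : D * D' = 1) :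
    (D' * P * D' * (D * N * D) * (D' * P * D') * (D * N * D)).trace = (P * N * (P * N)).trace := by
  have h' : D' * D = 1 := mul_eq_one_comm.1 h
  rw [show D' * P * D' * (D * N * D) * (D' * P * D') * (D * N * D) =
    D' * (P * (D' * D) * N * (D * D') * P * (D' * D) * N * D) by simp only [mul_assoc],
    Matrix.trace_mul_comm, h, h']
  simp only [mul_one, mul_assoc, h]

/-- The singular part of `J_ζ`: `D_ζ = D E`. -/
noncomputable def poleCoeff (u v : ℝ) : Fin 3 → ℂ := ![0, -Complex.I / (2 * u), 1 / (2 * v)]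

/-- The diagonal of `D = diag(1, u, v)`. -/
def frame (i : Fin 3) (u v : ℝ) : ℝ := ![1, u, v] i

lemma frame_ne_zero {u v : ℝ} (hu : 0 < u) (hv : 0 < v) (i : Fin 3) : frame i u v ≠ 0 := by
  fin_cases i <;> simp [frame, hu.ne', hv.ne']

lemma differentiable_frame (i : Fin 3) : Differentiable ℝ (fun p : ℝ × ℝ => frame i p.1 p.2) := by
  fin_cases i
  · exact differentiable_const _
  · exact differentiable_fst
  · exact differentiable_snd

lemma partialXi_frame {u v : ℝ} (hu : 0 < u) (hv : 0 < v) (i : Fin 3) :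
    partialXi (frame i) u v = frame i u v * poleCoeff u v i := by
  have hu' : (u : ℂ) ≠ 0 := by exact_mod_cast hu.ne'
  have hv' : (v : ℂ) ≠ 0 := by exact_mod_cast hv.ne'
  fin_cases i <;> simp [partialXi, partialR, partialZ, frame, poleCoeff] <;> field_simp

lemma norm_poleCoeff_le {u v : ℝ} (hu : 0 < u) (hv : 0 < v) (i : Fin 3) :
    ‖poleCoeff u v i‖ ≤ 1 / (2 * u) + 1 / (2 * v) := by
  have h1 : 0 < 1 / (2 * u) := by positivity
  have h2 : 0 < 1 / (2 * v) := by positivity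
  fin_cases i
  · simpa [poleCoeff] using (add_pos h1 h2).le
  · simp [poleCoeff, abs_of_pos hu] at *; linarith
  · simp [poleCoeff, abs_of_pos hv] at *; linarith

/-- The regular part of the normal form as a matrix function of `(u, v)`. -/
def regularMatrix (X Y Z U V W : ℝ → ℝ → ℝ) (u v : ℝ) : Matrix (Fin 3) (Fin 3) ℝ :=
  regularPart (X u v) (Y u v) (Z u v) (U u v) (V u v) (W u v) u v

lemma partialXi_frame_mul {K : ℝ → ℝ → ℝ} {u v : ℝ} (hu : 0 < u) (hv : 0 < v) (i j : Fin 3)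
    (hK : DifferentiableAt ℝ (fun p : ℝ × ℝ => K p.1 p.2) (u, v)) :
    partialXi (fun u v => frame i u v * K u v * frame j u v) u v =
      frame i u v * (poleCoeff u v i * K u v + partialXi K u v + K u v * poleCoeff u v j) *
        frame j u v := by
  have hi := (differentiable_frame i) (u, v)
  have hj := (differentiable_frame j) (u, v)
  rw [partialXi_mul (F := fun u v => frame i u v * K u v) (G := frame j) (hi.mul hK) hj,
    partialXi_mul hi hK, partialXi_frame hu hv, partialXi_frame hu hv]
  push_cast
  ring

lemma normalForm_eq {X Y Z U V W u v : ℝ} :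
    !![X, u ^ 2 * Y, v ^ 2 * Z; u ^ 2 * Y, u ^ 2 * U, u ^ 2 * v ^ 2 * V;
      v ^ 2 * Z, u ^ 2 * v ^ 2 * V, v ^ 2 * W] =
    Matrix.diagonal (fun i => frame i u v) * regularPart X Y Z U V W u v *
      Matrix.diagonal (fun i => frame i u v) := by
  ext i j
  rw [Matrix.mul_diagonal, Matrix.diagonal_mul]
  fin_cases i <;> fin_cases j <;> simp [frame, regularPart] <;> ring

lemma zeta_ne_zero {u v : ℝ} (hv : 0 < v) :
    (v + Complex.I * u : ℂ) ≠ 0 := fun h => hv.ne' (by simpa using congrArg Complex.re h)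

section

variable {J : ℝ → ℝ → Matrix (Fin 3) (Fin 3) ℝ} {ν : ℝ → ℝ → ℝ} {ε : ℝ}
  {X Y Z U V W : ℝ → ℝ → ℝ} {u v : ℝ}

/-- Both `det D` and `r` equal `u v`, so the degeneration of `J` at the rods lies entirely in `D`.
Hence `K⁻¹ = -adj K` is polynomial in the entries of `K` and stays bounded at the nut. -/
lemma det_regularMatrix (hvac : IsVacuum J ν ε) (hform : IsNutNormalForm J ε X Y Z U V W)
    (hu : 0 < u) (hv : 0 < v) (h : u ^ 2 + v ^ 2 < 2 * ε) :
    (regularMatrix X Y Z U V W u v).det = -1 := by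
  have := hvac.det _ _ (mem_halfDisc_weyl hu hv h)
  rw [hform.eq_form u v hu hv h, normalForm_eq, Matrix.det_mul, Matrix.det_mul,
    Matrix.det_diagonal] at this
  simp only [Fin.prod_univ_three, frame] at this
  simp at this
  have huv : (u * v) ^ 2 ≠ 0 := by positivity
  apply mul_left_cancel₀ huv
  rw [regularMatrix]
  linear_combination this

lemma invC_eq (hvac : IsVacuum J ν ε) (hform : IsNutNormalForm J ε X Y Z U V W)
    (hu : 0 < u) (hv : 0 < v) (h : u ^ 2 + v ^ 2 < 2 * ε) :
    invC J (u * v) ((v ^ 2 - u ^ 2) / 2) =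
      Matrix.diagonal (fun i => ((frame i u v)⁻¹ : ℂ)) *
        (-(regularMatrix X Y Z U V W u v).adjugate).map (fun x : ℝ => (x : ℂ)) *
        Matrix.diagonal (fun i => ((frame i u v)⁻¹ : ℂ)) := by
  have hdd : Matrix.diagonal (fun i => frame i u v) * Matrix.diagonal (fun i => (frame i u v)⁻¹) = 1 := by
    rw [Matrix.diagonal_mul_diagonal, ← Matrix.diagonal_one]
    congr 1; ext i; exact mul_inv_cancel₀ (frame_ne_zero hu hv i)
  have hKP : regularMatrix X Y Z U V W u v * -(regularMatrix X Y Z U V W u v).adjugate = 1 := by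
    rw [mul_neg, Matrix.mul_adjugate, det_regularMatrix hvac hform hu hv h]; simp
  have : (J (u * v) ((v ^ 2 - u ^ 2) / 2))⁻¹ = Matrix.diagonal (fun i => (frame i u v)⁻¹) *
        -(regularMatrix X Y Z U V W u v).adjugate *
        Matrix.diagonal (fun i => (frame i u v)⁻¹) := by
    apply Matrix.inv_eq_right_inv
    rw [hform.eq_form u v hu hv h, normalForm_eq]
    rw [show ∀ D K D' P : Matrix (Fin 3) (Fin 3) ℝ, D * K * D * (D' * P * D') =
      D * (K * (D * D') * P) * D' by intros; simp only [mul_assoc], hdd, mul_one]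
    rw [regularMatrix] at hKP
    rw [regularMatrix, hKP, mul_one, hdd]
  rw [invC, this]
  ext i j
  simp only [Matrix.map_apply, Matrix.mul_diagonal, Matrix.diagonal_mul]
  push_cast; rfl

/-- `J_ζ = D (E K + K_ζ + K E) D`. -/
lemma smul_matXi_eq (hvac : IsVacuum J ν ε) (hform : IsNutNormalForm J ε X Y Z U V W)
    (hu : 0 < u) (hv : 0 < v) (h : u ^ 2 + v ^ 2 < 2 * ε)
    (hK : ∀ i j, DifferentiableAt ℝ
      (fun p : ℝ × ℝ => regularMatrix X Y Z U V W p.1 p.2 i j) (u, v)) :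
    (v + Complex.I * u : ℂ) • matXi J (u * v) ((v ^ 2 - u ^ 2) / 2) =
      Matrix.diagonal (fun i => (frame i u v : ℂ)) *
        (Matrix.diagonal (poleCoeff u v) *
            (regularMatrix X Y Z U V W u v).map (fun x : ℝ => (x : ℂ)) +
          matXi (regularMatrix X Y Z U V W) u v +
          (regularMatrix X Y Z U V W u v).map (fun x : ℝ => (x : ℂ)) *
            Matrix.diagonal (poleCoeff u v)) *
        Matrix.diagonal (fun i => (frame i u v : ℂ)) := by
  ext i j
  have hd : DifferentiableAt ℝ (fun p : ℝ × ℝ => J p.1 p.2 i j) (u * v, (v ^ 2 - u ^ 2) / 2) :=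
    ((hvac.contDiff_J i j).contDiffAt
      ((isOpen_halfDisc ε).mem_nhds (mem_halfDisc_weyl hu hv h))).differentiableAt two_ne_zero
  -- The normal form is known only for `u, v > 0`; differentiating it requires the identity on a
  -- whole neighbourhood of the point.
  have hopen : IsOpen ((Set.Ioi 0 ×ˢ Set.Ioi 0) ∩ {p : ℝ × ℝ | p.1 ^ 2 + p.2 ^ 2 < 2 * ε}) := by
    rw [← interior_quarterDisc]; exact isOpen_interior
  have hcongr : ∀ᶠ p : ℝ × ℝ in 𝓝 (u, v), J (p.1 * p.2) ((p.2 ^ 2 - p.1 ^ 2) / 2) i j =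
      frame i p.1 p.2 * regularMatrix X Y Z U V W p.1 p.2 i j * frame j p.1 p.2 := by
    filter_upwards [hopen.mem_nhds (x := (u, v)) ⟨⟨hu, hv⟩, h⟩] with p hp
    rw [hform.eq_form p.1 p.2 hp.1.1 hp.1.2 hp.2, normalForm_eq, Matrix.mul_diagonal,
      Matrix.diagonal_mul, regularMatrix]
  have e1 := partialXi_weyl (F := fun r z => J r z i j) hd
  rw [partialXi_congr (G := fun u v => frame i u v * regularMatrix X Y Z U V W u v i j *
    frame j u v) hcongr, partialXi_frame_mul (K := fun u v => regularMatrix X Y Z U V W u v i j)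
    hu hv i j (hK i j)] at e1
  rw [Matrix.smul_apply, Matrix.mul_diagonal, Matrix.diagonal_mul, Matrix.add_apply,
    Matrix.add_apply, Matrix.mul_diagonal, Matrix.diagonal_mul]
  exact e1.symm

/-- The bounded contribution of `tr (K⁻¹ E K E) - tr E²`, real part. -/
noncomputable def crossRe (X Y Z U V W u v : ℝ) : ℝ :=
  (Y * (Y * W - v ^ 2 * V * Z) + v ^ 2 * V * (X * V - Y * Z)) / 4
    - (Z * (U * Z - u ^ 2 * Y * V) + u ^ 2 * V * (X * V - Y * Z)) / 4

/-- The bounded contribution of `tr (K⁻¹ E K E) - tr E²`, imaginary part. -/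
noncomputable def crossIm (X Y Z V u v : ℝ) : ℝ := u * v * V * (X * V - Y * Z) / 2

/-- The trace of the field equation in the coordinate `ζ`, with its poles at the rods split off. -/
lemma sq_mul_trace_eq (hvac : IsVacuum J ν ε) (hform : IsNutNormalForm J ε X Y Z U V W)
    (hu : 0 < u) (hv : 0 < v) (h : u ^ 2 + v ^ 2 < 2 * ε)
    (hK : ∀ i j, DifferentiableAt ℝ
      (fun p : ℝ × ℝ => regularMatrix X Y Z U V W p.1 p.2 i j) (u, v))
    {A B P E M : Matrix (Fin 3) (Fin 3) ℂ}
    (hA : A = invC J (u * v) ((v ^ 2 - u ^ 2) / 2))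
    (hB : B = matXi J (u * v) ((v ^ 2 - u ^ 2) / 2))
    (hP : P = (-(regularMatrix X Y Z U V W u v).adjugate).map (fun x : ℝ => (x : ℂ)))
    (hE : E = Matrix.diagonal (poleCoeff u v))
    (hM : M = matXi (regularMatrix X Y Z U V W) u v) :
    (v + Complex.I * u : ℂ) ^ 2 * (A * B * A * B).trace =
      -1 / (u : ℂ) ^ 2 + 1 / (v : ℂ) ^ 2 +
        (2 * ((crossRe (X u v) (Y u v) (Z u v) (U u v) (V u v) (W u v) u v : ℂ) -
          Complex.I * crossIm (X u v) (Y u v) (Z u v) (V u v) u v) +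
        2 * (E * P * M).trace + 2 * (P * E * M).trace + (P * M * (P * M)).trace) := by
  have hu' : (u : ℂ) ≠ 0 := by exact_mod_cast hu.ne'
  have hv' : (v : ℂ) ≠ 0 := by exact_mod_cast hv.ne'
  set K : Matrix (Fin 3) (Fin 3) ℂ :=
    (regularMatrix X Y Z U V W u v).map (fun x : ℝ => (x : ℂ)) with hKdef
  have hKr : K = regularPart (X u v : ℂ) (Y u v) (Z u v) (U u v) (V u v) (W u v) u v := by
    rw [hKdef, regularMatrix]
    ext i j; fin_cases i <;> fin_cases j <;> simp [regularPart]
  have hPK : P = -K.adjugate := by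
    have e := RingHom.map_adjugate Complex.ofRealHom (regularMatrix X Y Z U V W u v)
    rw [hP, hKdef]
    change _ = -(Complex.ofRealHom.mapMatrix (regularMatrix X Y Z U V W u v)).adjugate
    rw [← e]
    ext i j
    simp
  have hdet : K.det = -1 := by
    have e := RingHom.map_det Complex.ofRealHom (regularMatrix X Y Z U V W u v)
    rw [det_regularMatrix hvac hform hu hv h] at e
    exact e.symm.trans (by simp)
  have h1 : K * P = 1 := by rw [hPK, mul_neg, Matrix.mul_adjugate, hdet]; simp
  have h2 : P * K = 1 := mul_eq_one_comm.1 h1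
  have hDD : Matrix.diagonal (fun i => (frame i u v : ℂ)) *
      Matrix.diagonal (fun i => ((frame i u v)⁻¹ : ℂ)) = 1 := by
    rw [Matrix.diagonal_mul_diagonal, ← Matrix.diagonal_one]
    congr 1; ext i; exact mul_inv_cancel₀ (by exact_mod_cast frame_ne_zero hu hv i)
  have hsm : (v + Complex.I * u : ℂ) ^ 2 * (A * B * A * B).trace =
      (A * ((v + Complex.I * u : ℂ) • B) * A * ((v + Complex.I * u : ℂ) • B)).trace := by
    simp only [Matrix.mul_smul, Matrix.smul_mul, Matrix.trace_smul, smul_eq_mul]; ring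
  have hEE : (E * E).trace = -1 / (4 * (u : ℂ) ^ 2) + 1 / (4 * (v : ℂ) ^ 2) := by
    rw [hE, Matrix.diagonal_mul_diagonal, Matrix.trace_diagonal, Fin.sum_univ_three]
    simp only [poleCoeff]
    simp
    field_simp
    linear_combination 4 * (v : ℂ) ^ 2 * Complex.I_sq
  have hcross := trace_conj_regularPart (X u v : ℂ) (Y u v) (Z u v) (U u v) (V u v) (W u v) u v
    hu' hv' (by rw [← hKr, hdet])
  rw [← hKr, ← hPK, show Matrix.diagonal ![0, -Complex.I / (2 * (u : ℂ)), 1 / (2 * v)] = E from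
    hE.symm] at hcross
  rw [hsm, hA, hB, invC_eq hvac hform hu hv h, smul_matXi_eq hvac hform hu hv h hK, ← hP, ← hE,
    ← hM, ← hKdef, trace_sq_conj_diag hDD, Matrix.trace_sq_conj h1 h2, hEE, hcross, crossRe, crossIm]
  push_cast
  field_simp
  ring

end

/-! ### Cancellation of the poles and the gradient bound -/

/-- Logarithm of the conformal factor `e^{2ν} (u² + v²)` of `du² + dv²`. -/
noncomputable def logConformal (ν : ℝ → ℝ → ℝ) (u v : ℝ) : ℝ :=
  2 * ν (u * v) ((v ^ 2 - u ^ 2) / 2) + Real.log (u ^ 2 + v ^ 2)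

lemma partialXi_log_mul_exp {ν : ℝ → ℝ → ℝ} {r z : ℝ} (hr : 0 < r)
    (hν : DifferentiableAt ℝ (fun p : ℝ × ℝ => ν p.1 p.2) (r, z)) :
    partialXi (fun s y => Real.log (s * Real.exp (2 * ν s y))) r z =
      partialXi (fun s y => 2 * ν s y) r z - Complex.I / (2 * r) := by
  have h1 : ∀ᶠ p : ℝ × ℝ in 𝓝 (r, z),
      Real.log (p.1 * Real.exp (2 * ν p.1 p.2)) = 2 * ν p.1 p.2 + Real.log p.1 := by
    filter_upwards [(isOpen_lt continuous_const continuous_fst).mem_nhds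
      (show (r, z) ∈ {p : ℝ × ℝ | (0 : ℝ) < p.1} from hr)] with p hp
    rw [Real.log_mul (ne_of_gt hp) (Real.exp_pos _).ne', Real.log_exp, add_comm]
  rw [partialXi_congr (G := fun s y => 2 * ν s y + Real.log s) h1,
    partialXi_add (F := fun s y => 2 * ν s y) (G := fun s _ => Real.log s) (hν.const_mul 2)
      (differentiableAt_fst.log hr.ne')]
  have hr' : (r : ℂ) ≠ 0 := by exact_mod_cast hr.ne'
  have h2 : partialXi (fun s _ => Real.log s) r z = -Complex.I / (2 * r) := by
    simp [partialXi, partialR, partialZ]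
    field_simp
  rw [h2]; ring

section

variable {J : ℝ → ℝ → Matrix (Fin 3) (Fin 3) ℝ} {ν : ℝ → ℝ → ℝ} {ε : ℝ}
  {X Y Z U V W : ℝ → ℝ → ℝ} {u v : ℝ}

lemma differentiableAt_nu (hvac : IsVacuum J ν ε)
    (hu : 0 < u) (hv : 0 < v) (h : u ^ 2 + v ^ 2 < 2 * ε) :
    DifferentiableAt ℝ (fun p : ℝ × ℝ => ν p.1 p.2) (u * v, (v ^ 2 - u ^ 2) / 2) :=
  (hvac.contDiff_nu.contDiffAt
    ((isOpen_halfDisc ε).mem_nhds (mem_halfDisc_weyl hu hv h))).differentiableAt two_ne_zero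

lemma differentiableAt_weyl (hvac : IsVacuum J ν ε)
    (hu : 0 < u) (hv : 0 < v) (h : u ^ 2 + v ^ 2 < 2 * ε) :
    DifferentiableAt ℝ (fun p : ℝ × ℝ => 2 * ν (p.1 * p.2) ((p.2 ^ 2 - p.1 ^ 2) / 2)) (u, v) := by
  have hd : DifferentiableAt ℝ (fun p : ℝ × ℝ => (p.1 * p.2, (p.2 ^ 2 - p.1 ^ 2) / 2)) (u, v) := by
    fun_prop
  exact ((differentiableAt_nu hvac hu hv h).comp (u, v) hd).const_mul 2

lemma differentiableAt_log_sq_add_sq (hu : 0 < u) :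
    DifferentiableAt ℝ (fun p : ℝ × ℝ => Real.log (p.1 ^ 2 + p.2 ^ 2)) (u, v) := by
  have hd : DifferentiableAt ℝ (fun p : ℝ × ℝ => p.1 ^ 2 + p.2 ^ 2) (u, v) := by fun_prop
  exact hd.log (by positivity)

lemma differentiableAt_logConformal (hvac : IsVacuum J ν ε)
    (hu : 0 < u) (hv : 0 < v) (h : u ^ 2 + v ^ 2 < 2 * ε) :
    DifferentiableAt ℝ (fun p : ℝ × ℝ => logConformal ν p.1 p.2) (u, v) :=
  (differentiableAt_weyl hvac hu hv h).add (differentiableAt_log_sq_add_sq hu)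

/-- The poles of the trace at the rods cancel against `log r` and `log (u² + v²)`. -/
lemma partialXi_logConformal (hvac : IsVacuum J ν ε)
    (hu : 0 < u) (hv : 0 < v) (h : u ^ 2 + v ^ 2 < 2 * ε) {T R : ℂ}
    (hT : T = (invC J (u * v) ((v ^ 2 - u ^ 2) / 2) * matXi J (u * v) ((v ^ 2 - u ^ 2) / 2) *
      invC J (u * v) ((v ^ 2 - u ^ 2) / 2) * matXi J (u * v) ((v ^ 2 - u ^ 2) / 2)).trace)
    (hR : (v + Complex.I * u : ℂ) ^ 2 * T = -1 / (u : ℂ) ^ 2 + 1 / (v : ℂ) ^ 2 + R) :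
    (v + Complex.I * u : ℂ) * partialXi (logConformal ν) u v =
      Complex.I * (u * v) / 2 * R := by
  have hu' : (u : ℂ) ≠ 0 := by exact_mod_cast hu.ne'
  have hv' : (v : ℂ) ≠ 0 := by exact_mod_cast hv.ne'
  have hz := zeta_ne_zero (u := u) hv
  have hν := differentiableAt_nu hvac hu hv h
  have e1 := hvac.conformal_factor _ _ (mem_halfDisc_weyl hu hv h)
  rw [partialXi_log_mul_exp (mul_pos hu hv) hν, ← hT] at e1
  have e2 : partialXi (logConformal ν) u v = _ := partialXi_add
    (F := fun u v => 2 * ν (u * v) ((v ^ 2 - u ^ 2) / 2))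
    (G := fun u v => Real.log (u ^ 2 + v ^ 2)) (differentiableAt_weyl hvac hu hv h)
    (differentiableAt_log_sq_add_sq hu)
  rw [partialXi_log_sq_add_sq (by positivity),
    partialXi_weyl (F := fun r z => 2 * ν r z) (hν.const_mul 2), sub_eq_iff_eq_add.1 e1] at e2
  have e3 : R = (v + Complex.I * u : ℂ) ^ 2 * T - (-1 / (u : ℂ) ^ 2 + 1 / (v : ℂ) ^ 2) :=
    eq_sub_of_add_eq' hR.symm
  -- What remains is the cancellation `(i u v / 2)(-1/u² + 1/v²) + ζ² · i/(2uv) + 1 = 0`, whose last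
  -- two terms come from `log r` and `log (u² + v²)`.
  rw [e2, e3]
  push_cast
  field_simp
  linear_combination (Complex.I * u ^ 2 + 2 * u * v) * Complex.I_sq

lemma norm_partialXi_logConformal_le (hvac : IsVacuum J ν ε)
    (hform : IsNutNormalForm J ε X Y Z U V W)
    (hu : 0 < u) (hv : 0 < v) (h : u ^ 2 + v ^ 2 < 2 * ε) (hu1 : u ≤ 1) {C : ℝ}
    (hK : ∀ i j, DifferentiableAt ℝ
      (fun p : ℝ × ℝ => regularMatrix X Y Z U V W p.1 p.2 i j) (u, v))
    (hM : ∀ i j, ‖matXi (regularMatrix X Y Z U V W) u v i j‖ ≤ C)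
    (hP : ∀ i j, |(regularMatrix X Y Z U V W u v).adjugate i j| ≤ C)
    (hre : |crossRe (X u v) (Y u v) (Z u v) (U u v) (V u v) (W u v) u v| ≤ C)
    (him : |crossIm (X u v) (Y u v) (Z u v) (V u v) u v| ≤ C) :
    ‖partialXi (logConformal ν) u v‖ ≤ 2 * C + 41 * C ^ 4 + 54 * C ^ 2 := by
  have hC : 0 ≤ C := (abs_nonneg _).trans hre
  obtain ⟨P, hPd⟩ : ∃ P : Matrix (Fin 3) (Fin 3) ℂ, P =
    (-(regularMatrix X Y Z U V W u v).adjugate).map (fun x : ℝ => (x : ℂ)) := ⟨_, rfl⟩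
  obtain ⟨E, hEd⟩ : ∃ E : Matrix (Fin 3) (Fin 3) ℂ, E = Matrix.diagonal (poleCoeff u v) := ⟨_, rfl⟩
  obtain ⟨M, hMd⟩ : ∃ M : Matrix (Fin 3) (Fin 3) ℂ,
    M = matXi (regularMatrix X Y Z U V W) u v := ⟨_, rfl⟩
  have key := partialXi_logConformal hvac hu hv h rfl
    (sq_mul_trace_eq hvac hform hu hv h hK rfl rfl hPd hEd hMd)
  obtain ⟨b, hb⟩ : ∃ b : ℝ, b = 1 / (2 * u) + 1 / (2 * v) := ⟨_, rfl⟩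
  have hb0 : 0 ≤ b := by rw [hb]; positivity
  have bE : ∀ i j, ‖E i j‖ ≤ b := fun i j => by
    rw [hEd, Matrix.diagonal_apply]
    split_ifs
    · rw [hb]; exact norm_poleCoeff_le hu hv i
    · simpa using hb0
  have bP : ∀ i j, ‖P i j‖ ≤ C := fun i j => by
    rw [hPd]; simpa using hP i j
  have bM : ∀ i j, ‖M i j‖ ≤ C := fun i j => by rw [hMd]; exact hM i j
  have t1 := Matrix.norm_trace_le_of_entries (Matrix.norm_mul_apply_le_of_entries
    (Matrix.norm_mul_apply_le_of_entries bE bP) bM)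
  have t2 := Matrix.norm_trace_le_of_entries (Matrix.norm_mul_apply_le_of_entries
    (Matrix.norm_mul_apply_le_of_entries bP bE) bM)
  have bPM := Matrix.norm_mul_apply_le_of_entries bP bM
  have t3 := Matrix.norm_trace_le_of_entries (Matrix.norm_mul_apply_le_of_entries bPM bPM)
  have hS : ‖(crossRe (X u v) (Y u v) (Z u v) (U u v) (V u v) (W u v) u v : ℂ) -
          Complex.I * crossIm (X u v) (Y u v) (Z u v) (V u v) u v‖ ≤ 2 * C := by
    refine (norm_sub_le _ _).trans ?_
    rw [norm_mul, Complex.norm_I, Complex.norm_real, Complex.norm_real, Real.norm_eq_abs,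
      Real.norm_eq_abs]
    linarith
  generalize ((crossRe (X u v) (Y u v) (Z u v) (U u v) (V u v) (W u v) u v : ℂ) -
          Complex.I * crossIm (X u v) (Y u v) (Z u v) (V u v) u v) = S at key hS
  simp only [Fintype.card_fin, Nat.cast_ofNat] at t1 t2 t3
  -- A product of three 3 × 3 matrices has trace at most 27 times the product of the entry bounds,
  -- and two such traces enter with factor 2, giving 108; the product of four gives 81.
  have hR : ‖2 * S + 2 * (E * P * M).trace + 2 * (P * E * M).trace + (P * M * (P * M)).trace‖ ≤
      4 * C + 108 * (b * C ^ 2) + 81 * C ^ 4 := by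
    refine (norm_add_le _ _).trans ((add_le_add_left ((norm_add_le _ _).trans
      (add_le_add_left (norm_add_le _ _) _)) _).trans ?_)
    simp only [norm_mul, Complex.norm_ofNat]
    nlinarith [t1, t2, t3, hS]
  generalize 2 * S + 2 * (E * P * M).trace + 2 * (P * E * M).trace + (P * M * (P * M)).trace = R
    at key hR
  have hkey := congrArg norm key
  obtain ⟨n, hn⟩ : ∃ n : ℝ, n = ‖(v + Complex.I * u : ℂ)‖ := ⟨_, rfl⟩
  have hn0 : 0 < n := hn ▸ norm_pos_iff.2 (zeta_ne_zero hv)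
  have nv : v ≤ n := by
    rw [hn]; refine le_trans ?_ (Complex.re_le_norm _); simp
  have nu : u ≤ n := by
    rw [hn]; refine le_trans ?_ (Complex.im_le_norm _); simp
  rw [norm_mul, ← hn] at hkey
  simp only [norm_mul, norm_div, Complex.norm_I, Complex.norm_real, Real.norm_eq_abs,
    abs_of_pos hu, abs_of_pos hv, Complex.norm_ofNat, one_mul] at hkey
  -- The prefactor `u v` absorbs the simple poles: `u v b = (u + v) / 2`. The next bound is `u v ≤
  -- v`, from `u ≤ 1`.
  have huvb : u * v * b ≤ n := by
    rw [hb]; field_simp; linarith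
  have huv : u * v ≤ n := by nlinarith
  have : n * ‖partialXi (logConformal ν) u v‖ ≤ n * (2 * C + 41 * C ^ 4 + 54 * C ^ 2) := by
    rw [hkey]
    calc u * v / 2 * ‖R‖ ≤ u * v / 2 * (4 * C + 108 * (b * C ^ 2) + 81 * C ^ 4) := by gcongr
      _ = (u * v) * (2 * C + 81 / 2 * C ^ 4) + (u * v * b) * (54 * C ^ 2) := by ring
      _ ≤ n * (2 * C + 81 / 2 * C ^ 4) + n * (54 * C ^ 2) := by gcongr
      _ ≤ _ := by nlinarith [mul_nonneg hn0.le (pow_nonneg hC 4)]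
  exact le_of_mul_le_mul_left this hn0

end

/-! ### Uniform bounds near the nut and the continuous extension -/

section

variable {J : ℝ → ℝ → Matrix (Fin 3) (Fin 3) ℝ} {ν : ℝ → ℝ → ℝ} {ε : ℝ}
  {X Y Z U V W : ℝ → ℝ → ℝ}

lemma contDiffOn_regularMatrix (hform : IsNutNormalForm J ε X Y Z U V W) (i j : Fin 3) :
    ContDiffOn ℝ 1 (fun p : ℝ × ℝ => regularMatrix X Y Z U V W p.1 p.2 i j) (quarterDisc ε) := by
  obtain ⟨hX, hY, hZ, hU, hV, hW, -, -, -⟩ := hform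
  fin_cases i <;> fin_cases j <;> simp [regularMatrix, regularPart] <;> fun_prop

lemma contDiffOn_adjugate_regularMatrix (hform : IsNutNormalForm J ε X Y Z U V W) (i j : Fin 3) :
    ContDiffOn ℝ 1 (fun p : ℝ × ℝ => (regularMatrix X Y Z U V W p.1 p.2).adjugate i j)
      (quarterDisc ε) := by
  have hK := contDiffOn_regularMatrix hform
  simp only [Matrix.adjugate_fin_three]
  fin_cases i <;> fin_cases j <;> simp <;> fun_prop

lemma contDiffOn_crossRe (hform : IsNutNormalForm J ε X Y Z U V W) :
    ContDiffOn ℝ 1 (fun p : ℝ × ℝ => crossRe (X p.1 p.2) (Y p.1 p.2) (Z p.1 p.2) (U p.1 p.2)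
      (V p.1 p.2) (W p.1 p.2) p.1 p.2) (quarterDisc ε) := by
  obtain ⟨hX, hY, hZ, hU, hV, hW, -, -, -⟩ := hform
  unfold crossRe
  fun_prop

lemma contDiffOn_crossIm (hform : IsNutNormalForm J ε X Y Z U V W) :
    ContDiffOn ℝ 1 (fun p : ℝ × ℝ => crossIm (X p.1 p.2) (Y p.1 p.2) (Z p.1 p.2)
      (V p.1 p.2) p.1 p.2) (quarterDisc ε) := by
  obtain ⟨hX, hY, hZ, hU, hV, hW, -, -, -⟩ := hform
  unfold crossIm
  fun_prop

lemma zero_mem_quarterDisc (hε : 0 < ε) : (0 : ℝ × ℝ) ∈ quarterDisc ε := by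
  simp [quarterDisc, hε]

lemma exists_bound_partialXi_logConformal (hε : 0 < ε) (hvac : IsVacuum J ν ε)
    (hform : IsNutNormalForm J ε X Y Z U V W) :
    ∃ C, ∀ᶠ p in 𝓝[interior (quarterDisc ε)] (0 : ℝ × ℝ),
      ‖partialXi (logConformal ν) p.1 p.2‖ ≤ C := by
  have h0 := zero_mem_quarterDisc hε
  have hcv := convex_quarterDisc ε
  have h1 := eventually_all.2 fun i => eventually_all.2 fun j =>
    contDiffWithinAt_eventually_bound hcv h0 (contDiffOn_regularMatrix hform i j)
  have h2 := eventually_all.2 fun i => eventually_all.2 fun j =>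
    contDiffWithinAt_eventually_bound hcv h0 (contDiffOn_adjugate_regularMatrix hform i j)
  have h3 := contDiffWithinAt_eventually_bound hcv h0 (contDiffOn_crossRe hform)
  have h4 := contDiffWithinAt_eventually_bound hcv h0 (contDiffOn_crossIm hform)
  obtain ⟨C, c1, c2, c3, c4⟩ := (h1.and (h2.and (h3.and h4))).exists
  refine ⟨2 * C + 41 * C ^ 4 + 54 * C ^ 2, ?_⟩
  have hu1 : ∀ᶠ p in 𝓝[interior (quarterDisc ε)] (0 : ℝ × ℝ), p.1 ≤ 1 :=
    (continuous_fst.continuousAt.mono_left nhdsWithin_le_nhds).eventually_le_const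
      (by simp)
  filter_upwards [eventually_all.2 fun i => eventually_all.2 fun j => c1 i j,
    eventually_all.2 fun i => eventually_all.2 fun j => c2 i j, c3, c4, hu1, self_mem_nhdsWithin]
    with p d1 d2 d3 d4 d5 d6
  rw [interior_quarterDisc] at d6
  exact norm_partialXi_logConformal_le hvac hform d6.1.1 d6.1.2 d6.2 d5
    (fun i j => (d1 i j).2.1)
    (fun i j => norm_partialXi_le (F := fun u v => regularMatrix X Y Z U V W u v i j)
      (d1 i j).2.1 (d1 i j).2.2.1 (d1 i j).2.2.2)
    (fun i j => (d2 i j).1) d3.1 d4.1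

/-- The conformal factor extends continuously to the rods and the nut. -/
lemma exists_continuous_extension (hε : 0 < ε) (hvac : IsVacuum J ν ε)
    (hform : IsNutNormalForm J ε X Y Z U V W) :
    ∃ g : ℝ × ℝ → ℝ, Continuous g ∧ ∃ δ > 0, ∀ u v, 0 < u → 0 < v → u < δ → v < δ →
      logConformal ν u v = g (u, v) := by
  obtain ⟨C, hC⟩ := exists_bound_partialXi_logConformal hε hvac hform
  obtain ⟨ρ, hρ, hball⟩ := Metric.mem_nhdsWithin_iff.1 hC
  have hcv : Convex ℝ (Metric.ball (0 : ℝ × ℝ) ρ ∩ interior (quarterDisc ε)) :=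
    (convex_ball _ _).inter (convex_quarterDisc ε).interior
  have hL : LipschitzOnWith (4 * C).toNNReal (fun p : ℝ × ℝ => logConformal ν p.1 p.2)
      (Metric.ball (0 : ℝ × ℝ) ρ ∩ interior (quarterDisc ε)) := by
    have hd : ∀ p ∈ Metric.ball (0 : ℝ × ℝ) ρ ∩ interior (quarterDisc ε),
        DifferentiableAt ℝ (fun p : ℝ × ℝ => logConformal ν p.1 p.2) p := fun p hp => by
      have := hp.2
      rw [interior_quarterDisc] at this
      exact differentiableAt_logConformal hvac this.1.1 this.1.2 this.2
    refine hcv.lipschitzOnWith_of_nnnorm_fderiv_le (𝕜 := ℝ) hd fun p hp => ?_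
    rw [← NNReal.coe_le_coe, coe_nnnorm]
    exact (norm_fderiv_le_of_partialXi (hd p hp) (hball hp)).trans (Real.le_coe_toNNReal _)
  obtain ⟨g, hg, heq⟩ := hL.extend_real
  -- From `u < ε` and `u < 1` follows `u² < ε`, and likewise for `v`, so the square of side `δ` lies
  -- in the quarter disc.
  refine ⟨g, hg.continuous, min ρ (min ε 1), by positivity, fun u v hu hv hu' hv' => heq (x := (u, v)) ?_⟩
  obtain ⟨a1, a2, a3⟩ : u < ρ ∧ u < ε ∧ u < 1 := by simpa using hu'
  obtain ⟨b1, b2, b3⟩ : v < ρ ∧ v < ε ∧ v < 1 := by simpa using hv'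
  refine ⟨?_, ?_⟩
  · rw [mem_ball_zero_iff, Prod.norm_def, max_lt_iff, Real.norm_eq_abs, Real.norm_eq_abs,
      abs_of_pos hu, abs_of_pos hv]
    exact ⟨a1, b1⟩
  · rw [interior_quarterDisc]
    refine ⟨⟨hu, hv⟩, ?_⟩
    change u ^ 2 + v ^ 2 < 2 * ε
    nlinarith

end

/-! ### Conical regularity and the values of the conformal factor on the rods -/

/-- A small circle of circumference `2π u √(A u)` and radius `∫₀ᵘ f`. -/
lemma sqrt_eq_of_tendsto_circumference {A f : ℝ → ℝ} {a : ℝ} (hf : Continuous f) (hf0 : 0 < f 0)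
    (hA : Tendsto A (𝓝[>] 0) (𝓝 a))
    (h : Tendsto (fun u => 2 * Real.pi * (u * √(A u)) / ∫ s in (0 : ℝ)..u, f s) (𝓝[>] 0)
      (𝓝 (2 * Real.pi))) : √a = f 0 := by
  have hd : HasDerivAt (fun u => ∫ s in (0 : ℝ)..u, f s) (f 0) 0 :=
    intervalIntegral.integral_hasDerivAt_right (hf.intervalIntegrable _ _)
      (hf.stronglyMeasurableAtFilter _ _) hf.continuousAt
  -- The radius is asymptotic to `u f(0)`, so the ratio of circumference to radius tends to `2π √a /
  -- f(0)`.
  have hs : Tendsto (fun u => (∫ s in (0 : ℝ)..u, f s) / u) (𝓝[>] 0) (𝓝 (f 0)) := by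
    have := (hasDerivAt_iff_tendsto_slope_zero.1 hd).mono_left
      (nhdsWithin_mono 0 fun x (hx : 0 < x) => hx.ne')
    refine this.congr fun u => ?_
    simp [div_eq_inv_mul]
  have h2 := ((hA.sqrt.const_mul (2 * Real.pi)).div hs hf0.ne')
  have h3 := tendsto_nhds_unique h (h2.congr' ?_)
  · have hpi := Real.two_pi_pos.ne'
    rw [eq_div_iff hf0.ne'] at h3
    exact (mul_left_cancel₀ hpi h3).symm
  · filter_upwards [self_mem_nhdsWithin] with u (hu : 0 < u)
    simp only [Pi.div_apply]
    rw [div_div_eq_mul_div]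
    ring

lemma sqrt_metric_conformal {ν : ℝ → ℝ → ℝ} {u v g : ℝ} (hu : 0 < u)
    (h : logConformal ν u v = g) :
    √(Real.exp (2 * ν (u * v) ((v ^ 2 - u ^ 2) / 2)) * (u ^ 2 + v ^ 2)) = Real.exp (g / 2) := by
  have hp : 0 < u ^ 2 + v ^ 2 := by positivity
  rw [Real.exp_half, ← h, logConformal, Real.exp_add, Real.exp_log hp]

section

variable {J : ℝ → ℝ → Matrix (Fin 3) (Fin 3) ℝ} {ν : ℝ → ℝ → ℝ} {ε : ℝ}
  {X Y Z U V W : ℝ → ℝ → ℝ} {g : ℝ × ℝ → ℝ} {δ : ℝ}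

lemma eq_exp_of_sqrt_eq {a b : ℝ} (h : √a = Real.exp (b / 2)) : a = Real.exp b := by
  have ha : 0 ≤ a := by
    -- The real square root vanishes on nonpositive numbers, so the positive right-hand side already
    -- determines the sign of `a`.
    by_contra! hn
    rw [Real.sqrt_eq_zero_of_nonpos hn.le] at h
    exact (Real.exp_pos _).ne h
  rw [← Real.sq_sqrt ha, h, ← Real.exp_nat_mul]
  congr 1; push_cast; ring

lemma U_eq_exp (hform : IsNutNormalForm J ε X Y Z U V W) (hφ : NoConicalPhi J ν ε)
    (hg : Continuous g) (hgν : ∀ u v, 0 < u → 0 < v → u < δ → v < δ → logConformal ν u v = g (u, v))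
    {v : ℝ} (hv : 0 < v) (hvδ : v < δ) (hvε : v ^ 2 < 2 * ε) : U 0 v = Real.exp (g (0, v)) := by
  refine eq_exp_of_sqrt_eq (sqrt_eq_of_tendsto_circumference (A := fun u => U u v)
    (f := fun s => Real.exp (g (s, v) / 2)) (by fun_prop) (Real.exp_pos _) ?_ ?_)
  · have hmem : ((0 : ℝ), v) ∈ quarterDisc ε := ⟨le_rfl, hv.le, by simpa using hvε⟩
    have hmap : Tendsto (fun u : ℝ => (u, v)) (𝓝[>] 0) (𝓝[quarterDisc ε] (0, v)) := by
      refine tendsto_nhdsWithin_iff.2 ⟨(Continuous.prodMk continuous_id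
        continuous_const).continuousAt.tendsto.mono_left nhdsWithin_le_nhds, ?_⟩
      have hlt : ∀ᶠ u : ℝ in 𝓝[>] 0, u ^ 2 + v ^ 2 < 2 * ε :=
        ((show Continuous fun u : ℝ => u ^ 2 + v ^ 2 by fun_prop).continuousAt.mono_left
          nhdsWithin_le_nhds).eventually_lt_const (by simpa using hvε)
      filter_upwards [hlt, self_mem_nhdsWithin] with u h1 (h2 : 0 < u) using ⟨h2.le, hv.le, h1⟩
    exact (hform.contDiff_U.continuousOn _ hmem).tendsto.comp hmap
  · refine (hφ v hv hvε).congr' ?_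
    have hlt : ∀ᶠ u : ℝ in 𝓝[>] 0, u ^ 2 + v ^ 2 < 2 * ε :=
      ((show Continuous fun u : ℝ => u ^ 2 + v ^ 2 by fun_prop).continuousAt.mono_left
        nhdsWithin_le_nhds).eventually_lt_const (by simpa using hvε)
    filter_upwards [hlt, self_mem_nhdsWithin, Ioo_mem_nhdsGT (hv.trans hvδ)] with u h1 (h2 : 0 < u) h3
    congr 1
    · rw [circumferencePhi, intervalIntegral.integral_const, smul_eq_mul, sub_zero, metric,
        Matrix.fromBlocks_apply₁₁, hform.eq_form u v h2 hv h1]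
      simp [Real.sqrt_mul (sq_nonneg u), Real.sqrt_sq h2.le]
    -- The integrands are compared only on `(0, u]`: at `s = 0` the value of `ν` lies on the axis,
    -- outside the half disc, and is unconstrained.
    · refine intervalIntegral.integral_congr_ae (Eventually.of_forall fun s hs => ?_)
      rw [Set.uIoc_of_le h2.le] at hs
      rw [metric, Matrix.fromBlocks_apply₂₂]
      simpa using sqrt_metric_conformal hs.1 (hgν s v hs.1 hv (hs.2.trans_lt h3.2) hvδ)

lemma W_eq_exp (hform : IsNutNormalForm J ε X Y Z U V W) (hψ : NoConicalPsi J ν ε)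
    (hg : Continuous g) (hgν : ∀ u v, 0 < u → 0 < v → u < δ → v < δ → logConformal ν u v = g (u, v))
    {u : ℝ} (hu : 0 < u) (huδ : u < δ) (huε : u ^ 2 < 2 * ε) : W u 0 = Real.exp (g (u, 0)) := by
  refine eq_exp_of_sqrt_eq (sqrt_eq_of_tendsto_circumference (A := fun v => W u v)
    (f := fun s => Real.exp (g (u, s) / 2)) (by fun_prop) (Real.exp_pos _) ?_ ?_)
  · have hmem : (u, (0 : ℝ)) ∈ quarterDisc ε := ⟨hu.le, le_rfl, by simpa using huε⟩
    have hmap : Tendsto (fun v : ℝ => (u, v)) (𝓝[>] 0) (𝓝[quarterDisc ε] (u, 0)) := by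
      refine tendsto_nhdsWithin_iff.2 ⟨(Continuous.prodMk continuous_const
        continuous_id).continuousAt.tendsto.mono_left nhdsWithin_le_nhds, ?_⟩
      have hlt : ∀ᶠ v : ℝ in 𝓝[>] 0, u ^ 2 + v ^ 2 < 2 * ε :=
        ((show Continuous fun v : ℝ => u ^ 2 + v ^ 2 by fun_prop).continuousAt.mono_left
          nhdsWithin_le_nhds).eventually_lt_const (by simpa using huε)
      filter_upwards [hlt, self_mem_nhdsWithin] with v h1 (h2 : 0 < v) using ⟨hu.le, h2.le, h1⟩
    exact (hform.contDiff_W.continuousOn _ hmem).tendsto.comp hmap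
  · refine (hψ u hu huε).congr' ?_
    have hlt : ∀ᶠ v : ℝ in 𝓝[>] 0, u ^ 2 + v ^ 2 < 2 * ε :=
      ((show Continuous fun v : ℝ => u ^ 2 + v ^ 2 by fun_prop).continuousAt.mono_left
        nhdsWithin_le_nhds).eventually_lt_const (by simpa using huε)
    filter_upwards [hlt, self_mem_nhdsWithin, Ioo_mem_nhdsGT (hu.trans huδ)] with v h1 (h2 : 0 < v) h3
    congr 1
    · rw [circumferencePsi, intervalIntegral.integral_const, smul_eq_mul, sub_zero, metric,
        Matrix.fromBlocks_apply₁₁, hform.eq_form u v hu h2 h1]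
      simp [Real.sqrt_mul (sq_nonneg v), Real.sqrt_sq h2.le]
    · refine intervalIntegral.integral_congr_ae (Eventually.of_forall fun s hs => ?_)
      rw [Set.uIoc_of_le h2.le] at hs
      rw [metric, Matrix.fromBlocks_apply₂₂]
      simpa using sqrt_metric_conformal hu (hgν u s hu hs.1 huδ (hs.2.trans_lt h3.2))

end

end Nut

theorem mainTheorem5 (J : ℝ → ℝ → Matrix (Fin 3) (Fin 3) ℝ) (ν : ℝ → ℝ → ℝ) (ε : ℝ)
    (X₀ Y₀ Z₀ U₀ V₀ W₀ : ℝ → ℝ → ℝ) (hε : 0 < ε)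
    (hvac : Nut.IsVacuum J ν ε)
    (hform : Nut.IsNutNormalForm J ε X₀ Y₀ Z₀ U₀ V₀ W₀)
    (hφ : Nut.NoConicalPhi J ν ε) (hψ : Nut.NoConicalPsi J ν ε) :
    ∃ L : ℝ, Tendsto (fun v => U₀ 0 v) (𝓝[>] 0) (𝓝 L) ∧
      Tendsto (fun u => W₀ u 0) (𝓝[>] 0) (𝓝 L) := by
  obtain ⟨g, hg, δ, hδ, hgν⟩ := Nut.exists_continuous_extension hε hvac hform
  have hsmall : ∀ᶠ t : ℝ in 𝓝[>] 0, t ^ 2 < 2 * ε :=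
    ((show Continuous fun t : ℝ => t ^ 2 by fun_prop).continuousAt.mono_left
      nhdsWithin_le_nhds).eventually_lt_const (by simpa using hε)
  -- The common limit is the value of the extended conformal factor at the nut, approached along
  -- either rod.
  refine ⟨Real.exp (g (0, 0)), ?_, ?_⟩
  · have hlim : Tendsto (fun v : ℝ => Real.exp (g (0, v))) (𝓝[>] 0) (𝓝 (Real.exp (g (0, 0)))) :=
      (show Continuous fun v : ℝ => Real.exp (g (0, v)) by fun_prop).continuousAt.mono_left
        nhdsWithin_le_nhds
    refine hlim.congr' ?_
    filter_upwards [hsmall, Ioo_mem_nhdsGT hδ] with v h1 h2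
    exact (Nut.U_eq_exp hform hφ hg hgν h2.1 h2.2 h1).symm
  · have hlim : Tendsto (fun u : ℝ => Real.exp (g (u, 0))) (𝓝[>] 0) (𝓝 (Real.exp (g (0, 0)))) :=
      (show Continuous fun u : ℝ => Real.exp (g (u, 0)) by fun_prop).continuousAt.mono_left
        nhdsWithin_le_nhds
    refine hlim.congr' ?_
    filter_upwards [hsmall, Ioo_mem_nhdsGT hδ] with u h1 h2
    exact (Nut.W_eq_exp hform hψ hg hgν h2.1 h2.2 h1).symm
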